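/- Let $\Gamma=(V,E)$ be a countable undirected graph without loops or multiple edges, and let $A_\Gamma^+$ be its right-angled Artin monoid, i.e. the graph product over $\Gamma$ of copies of $\mathbb N$, one for each vertex: the quotient of the free product $\ast_{v\in V}\mathbb N$ by the congruence generated by $st=ts$ whenever $s,t$ lie in the copies of $\mathbb N$ at two adjacent vertices. The coconnected components $\Gamma_i$ ($i\in I$) of $\Gamma$ are the subgraphs of $\Gamma$ induced on the vertex sets of the connected components of the opposite (complement) graph of $\Gamma$, so that $A_\Gamma^+=\bigoplus_{i\in I}A_{\Gamma_i}^+$. The following are equivalent: (1) Every coconnected component $\Gamma_i$ with finitely many vertices is edge-free. (2) Every finitely generated one among the direct summands $A_{\Gamma_i}^+$ ($i\in I$) of $A_\Gamma^+$ is a free monoid. (2') Every finitely generated, directly indecomposable direct summand of $A_\Gamma^+$ is a free monoid. (A monoid $M$ is a direct summand of $A$ if $A\cong M\times N$ for some monoid $N$; $M$ is directly indecomposable if it is nontrivial and $M\cong N\times P$ forces $N$ or $P$ to be trivial.) (3) $A_\Gamma^+$ has property (AR). Here, for a monoid $S$, write $s\perp t$ if $sS\cap tS=\emptyset$. A finite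 subset $F\subset S$ is a foundation set if for every $s\in S$ there is $f\in F$ with $f\not\perp s$; a subset $F$ is accurate if $f\perp f'$ for all distinct $f,f'\in F$. The monoid $S$ has property (AR) if for every foundation set $F$ there is an accurate foundation set $F'$ with $F'\subset FS$. -/

import Mathlib

universe u v

section Monoids

/-- Elements `s, t` of a monoid are orthogonal, `s ⊥ t`, if `sS ∩ tS = ∅`. -/
def MonoidOrthogonal {S : Type u} [Monoid S] (s t : S) : Prop :=
  Set.range (fun a : S => s * a) ∩ Set.range (fun a : S => t * a) = ∅

/-- A foundation set: a finite subset `F` such that no `s` is orthogonal to all elements of `F`. -/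
def IsFoundationSet {S : Type u} [Monoid S] (F : Set S) : Prop :=
  F.Finite ∧ ∀ s : S, ∃ f ∈ F, ¬ MonoidOrthogonal f s

/-- A subset is accurate if its elements are pairwise orthogonal. -/
def IsAccurate {S : Type u} [Monoid S] (F : Set S) : Prop :=
  ∀ f ∈ F, ∀ f' ∈ F, f ≠ f' → MonoidOrthogonal f f'

/-- The accurate refinement property (AR): every foundation set `F` has an accurate refinement,
that is, an accurate foundation set `F'` with `F' ⊆ FS`. -/
def HasPropertyAR (S : Type u) [Monoid S] : Prop :=
  ∀ F : Set S, IsFoundationSet F →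
    ∃ F' : Set S, IsFoundationSet F' ∧ IsAccurate F' ∧ ∀ x ∈ F', ∃ f ∈ F, ∃ a : S, x = f * a

/-- A free monoid: one that is isomorphic to the monoid of words over some alphabet. -/
def IsFreeMonoid (M : Type u) [Monoid M] : Prop :=
  ∃ α : Type u, Nonempty (M ≃* FreeMonoid α)

/-- `M` is (isomorphic to) a direct summand of `A`. -/
def IsDirectSummand (M A : Type u) [Monoid M] [Monoid A] : Prop :=
  ∃ (N : Type u) (_ : Monoid N), Nonempty (A ≃* M × N)

/-- A nontrivial monoid that is not a direct sum of two nontrivial monoids. -/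
def IsDirectlyIndecomposable (M : Type u) [Monoid M] : Prop :=
  Nontrivial M ∧ ∀ (N P : Type u) [Monoid N] [Monoid P],
    Nonempty (M ≃* N × P) → Subsingleton N ∨ Subsingleton P

end Monoids

section GraphProducts

/-- The relations of a graph product: `st ~ ts` for `s ∈ S_v`, `t ∈ S_w` and adjacent `v, w`. -/
inductive GraphProductRel {V : Type u} (Γ : SimpleGraph V) (S : V → Type v)
    [∀ x, Monoid (S x)] : Monoid.CoprodI S → Monoid.CoprodI S → Prop
  | comm (x y : V) (h : Γ.Adj x y) (s : S x) (t : S y) :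
      GraphProductRel Γ S (Monoid.CoprodI.of s * Monoid.CoprodI.of t)
        (Monoid.CoprodI.of t * Monoid.CoprodI.of s)

/-- The graph product of a family of monoids: the quotient of their free product by the congruence
that makes elements of adjacent vertex monoids commute. -/
abbrev GraphProduct {V : Type u} (Γ : SimpleGraph V) (S : V → Type v) [∀ x, Monoid (S x)] :
    Type (max u v) :=
  (conGen (GraphProductRel Γ S)).Quotient

/-- The right-angled Artin monoid `A_Γ⁺`: the graph product with all vertex monoids equal to `ℕ`. -/
abbrev RAArtinMonoid {V : Type u} (Γ : SimpleGraph V) : Type u :=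
  GraphProduct Γ (fun _ : V => Multiplicative ℕ)

/-- The coconnected components of `Γ` are the connected components of the opposite graph `Γᶜ`. -/
abbrev CoconnectedComponent {V : Type u} (Γ : SimpleGraph V) : Type u :=
  Γᶜ.ConnectedComponent

/-- A coconnected component, as an induced subgraph of `Γ` (and not of `Γᶜ`). -/
abbrev CoconnectedComponent.graph {V : Type u} {Γ : SimpleGraph V}
    (C : CoconnectedComponent Γ) : SimpleGraph C.supp :=
  Γ.induce C.supp

end GraphProducts

/-!
Everything rests on homomorphisms out of `A_Γ⁺`, which are given by their values on the generators
(`RAArtinMonoid.lift`): the content (how often each letter occurs), the length, the projections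
`proj` to words over an independent set of vertices, and the retractions onto the monoids of induced
subgraphs. No normal form and no cancellation in `A_Γ⁺` is needed.

*Free summands.* Generators are atoms. A finitely generated `A_Γ⁺` has finitely many generators, and
atoms of a free monoid commute only if they are equal, so a free `A_Γ⁺` has no edges. An isomorphism
`A_Γ⁺ ≃* M × N` sends each atom to one of the factors, and atoms in different factors commute, so
that vertices joined by a path in `Γᶜ` go to the same factor. Hence `M` is the monoid of an induced
subgraph on a union of coconnected components (`fstEquiv`), and the directly indecomposable summands
are the `A_{Γ_i}⁺` (`isDirectlyIndecomposable`, `exists_mulEquiv_of_isDirectSummand`).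

*Blocking.* If the projection of `s` to words in two noncommuting letters `u`, `v` starts with a
high power of `u`, then a short `f` with a common right multiple with `s` cannot contain `v`
(`Blocks.count_eq_zero`). A product of high powers along paths in `Γᶜ` that issue from a set `R`
blocks any finite set of letters reachable from `R`, except those in `R` (`exists_forall_blocks`).

*No accurate refinement.* Let `C` be a finite component with an edge `ab`. The generators in `C` form
a foundation set. In an accurate foundation set refining it, blocking all letters of `C` but `a` gives an
element `a ^ k * g`, and likewise one `b ^ l * h`, with `g`, `h` supported outside `C`; multiplying
the blocking elements by a suitable element outside `C` makes `g` and `h` left divisors of one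
element. Then the two have a common right multiple, so accuracy makes them equal; they contain no
letter of `C`, which contradicts that they lie in `C A_Γ⁺` (`graph_eq_bot_of_hasPropertyAR`).

*Accurate refinement.* Suppose that all finite components are edge-free, and let `F` be a foundation
set. In an infinite component there is a letter not used by `F`, and blocking from there shows that
the elements of `F` without letters in infinite components do the work of `F`. They lie in a finite
direct sum of finitely generated free monoids, in which the tuples of words of a fixed large length
form an accurate refinement (`balanced`, `hasPropertyAR_of_graph_eq_bot`).
-/

/-! ### Generators, universal property and induction -/

namespace RAArtinMonoid

variable {V : Type u} {Γ : SimpleGraph V}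

/-- The generator of `A_Γ⁺` at the vertex `v`. -/
def gen (Γ : SimpleGraph V) (v : V) : RAArtinMonoid Γ :=
  (conGen (GraphProductRel Γ (fun _ : V => Multiplicative ℕ))).mk'
    (Monoid.CoprodI.of (i := v) (Multiplicative.ofAdd 1))

theorem gen_commute {u v : V} (h : Γ.Adj u v) : Commute (gen Γ u) (gen Γ v) :=
  (Con.eq _).2 (ConGen.Rel.of _ _ (GraphProductRel.comm u v h _ _))

/-- The universal property of `A_Γ⁺`: a map on vertices that sends adjacent vertices to commuting
elements extends to a homomorphism. -/
def lift {M : Type*} [Monoid M] (f : V → M) (hf : ∀ u v, Γ.Adj u v → Commute (f u) (f v)) :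
    RAArtinMonoid Γ →* M :=
  Con.lift _ (Monoid.CoprodI.lift fun v => powersHom M (f v)) <| Con.conGen_le.2 <| by
    rintro _ _ ⟨x, y, h, s, t⟩
    simpa [Con.ker_rel] using ((hf x y h).pow_pow _ _).eq

@[simp]
theorem lift_gen {M : Type*} [Monoid M] (f : V → M)
    (hf : ∀ u v, Γ.Adj u v → Commute (f u) (f v)) (v : V) : lift f hf (gen Γ v) = f v := by
  simp [lift, gen]

theorem closure_range_gen : Submonoid.closure (Set.range (gen Γ)) = ⊤ := by
  rw [eq_top_iff]
  rintro x -
  obtain ⟨w, rfl⟩ := Con.mk'_surjective x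
  induction w using Monoid.CoprodI.induction_on with
  | one => simp
  | of v m =>
    have : Monoid.CoprodI.of (M := fun _ : V => Multiplicative ℕ) (i := v) m =
        Monoid.CoprodI.of (i := v) (Multiplicative.ofAdd 1) ^ m.toAdd := by
      rw [← map_pow, ← ofAdd_nsmul]
      simp
    rw [this, map_pow]
    exact pow_mem (Submonoid.subset_closure (Set.mem_range_self v)) _
  | mul x y hx hy =>
    rw [map_mul]
    exact mul_mem hx hy

@[elab_as_elim]
theorem induction {p : RAArtinMonoid Γ → Prop} (x : RAArtinMonoid Γ) (one : p 1)
    (gen_mul : ∀ v x, p x → p (gen Γ v * x)) : p x := by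
  have hx : x ∈ Submonoid.closure (Set.range (gen Γ)) := by simp [closure_range_gen]
  induction hx using Submonoid.closure_induction_left with
  | one => exact one
  | mul_left y hy z _ ih =>
    obtain ⟨v, rfl⟩ := hy
    exact gen_mul v z ih

theorem hom_ext {M : Type*} [Monoid M] {f g : RAArtinMonoid Γ →* M}
    (h : ∀ v, f (gen Γ v) = g (gen Γ v)) : f = g :=
  MonoidHom.eq_of_eqOn_denseM closure_range_gen (by rintro _ ⟨v, rfl⟩; exact h v)

/-! ### Content and length -/

/-- The homomorphism to the free commutative monoid that records how often each generator
occurs. -/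
noncomputable def content : RAArtinMonoid Γ →* Multiplicative (V →₀ ℕ) :=
  lift (fun v => Multiplicative.ofAdd (Finsupp.single v 1)) fun _ _ _ => Commute.all _ _

/-- The number of occurrences of the generator at `v` in `x`. -/
noncomputable def count (x : RAArtinMonoid Γ) (v : V) : ℕ := (content x).toAdd v

@[simp] theorem count_one (v : V) : count (1 : RAArtinMonoid Γ) v = 0 := by simp [count]

@[simp] theorem count_mul (x y : RAArtinMonoid Γ) (v : V) :
    count (x * y) v = count x v + count y v := by simp [count]

@[simp] theorem count_gen_self (v : V) : count (gen Γ v) v = 1 := by simp [count, content]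

@[simp] theorem count_gen_of_ne {u v : V} (h : u ≠ v) : count (gen Γ u) v = 0 := by
  simp [count, content, h]

@[simp] theorem count_pow (x : RAArtinMonoid Γ) (n : ℕ) (v : V) :
    count (x ^ n) v = n * count x v := by
  induction n with
  | zero => simp
  | succ n ih => simp [pow_succ, ih, add_mul]

theorem finite_count_ne_zero (x : RAArtinMonoid Γ) : {v | count x v ≠ 0}.Finite :=
  (content x).toAdd.hasFiniteSupport

theorem gen_injective : Function.Injective (gen Γ) := by
  intro u v h
  by_contra hne
  simpa [hne] using congrArg (count · v) h

/-- The length homomorphism of `A_Γ⁺`. -/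
def lengthHom : RAArtinMonoid Γ →* Multiplicative ℕ :=
  lift (fun _ => Multiplicative.ofAdd 1) fun _ _ _ => Commute.all _ _

/-- The length of an element of `A_Γ⁺` as a word in the generators. -/
def length (x : RAArtinMonoid Γ) : ℕ := (lengthHom x).toAdd

@[simp] theorem length_one : length (1 : RAArtinMonoid Γ) = 0 := by simp [length]

@[simp] theorem length_mul (x y : RAArtinMonoid Γ) : length (x * y) = length x + length y := by
  simp [length]

@[simp] theorem length_gen (v : V) : length (gen Γ v) = 1 := by simp [length, lengthHom]

theorem eq_one_of_length_eq_zero {x : RAArtinMonoid Γ} (h : length x = 0) : x = 1 := by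
  induction x using induction with
  | one => rfl
  | gen_mul v x _ => simp at h

theorem eq_one_of_count_eq_zero {x : RAArtinMonoid Γ} (h : ∀ v, count x v = 0) : x = 1 := by
  induction x using induction with
  | one => rfl
  | gen_mul v x _ => simpa using h v

theorem gen_ne_one (v : V) : gen Γ v ≠ 1 := fun h => by simpa using congrArg length h

/-- Generators are atoms, and `A_Γ⁺` has no nontrivial units. -/
theorem eq_one_or_eq_one_of_mul_eq_gen {x y : RAArtinMonoid Γ} {v : V} (h : x * y = gen Γ v) :
    x = 1 ∨ y = 1 := by
  have := congrArg length h
  rw [length_mul, length_gen] at this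
  rcases Nat.eq_zero_or_pos (length x) with hx | hx
  · exact .inl (eq_one_of_length_eq_zero hx)
  · exact .inr (eq_one_of_length_eq_zero (by omega))

/-! ### Projections to free monoids -/

open Classical in
/-- The projection of `A_Γ⁺` to words over an independent set `P` of vertices: it deletes all
other letters. The target is the monoid of words over all of `V`, so that `P` does not enter the
types. -/
noncomputable def proj (P : Set V) (hP : Γ.IsIndepSet P) : RAArtinMonoid Γ →* FreeMonoid V :=
  lift (fun v => if v ∈ P then FreeMonoid.of v else 1) fun u v h => by
    by_cases hu : u ∈ P
    · have hv : v ∉ P := fun hv => hP hu hv h.ne h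
      simp [hv]
    · simp [hu]

section proj

variable {P : Set V} {hP : Γ.IsIndepSet P}

@[simp] theorem proj_gen_of_mem {v : V} (hv : v ∈ P) :
    proj P hP (gen Γ v) = FreeMonoid.of v := by simp [proj, hv]

@[simp] theorem proj_gen_of_notMem {v : V} (hv : v ∉ P) : proj P hP (gen Γ v) = 1 := by
  simp [proj, hv]

theorem mem_toList_proj {x : RAArtinMonoid Γ} {v : V} :
    v ∈ (proj P hP x).toList ↔ v ∈ P ∧ count x v ≠ 0 := by
  induction x using induction with
  | one => simp
  | gen_mul u x ih =>
    by_cases hu : u ∈ P <;> by_cases huv : u = v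
    · subst huv; simp [hu]
    · simp [hu, huv, ih, Ne.symm huv]
    · subst huv; simp [hu, ih]
    · simp [hu, huv, ih]

theorem proj_eq_one {x : RAArtinMonoid Γ} (h : ∀ v ∈ P, count x v = 0) : proj P hP x = 1 := by
  apply FreeMonoid.toList.injective
  refine List.eq_nil_iff_forall_not_mem.2 fun v hv => ?_
  rw [mem_toList_proj] at hv
  exact hv.2 (h v hv.1)

theorem length_proj_le (x : RAArtinMonoid Γ) : (proj P hP x).toList.length ≤ length x := by
  induction x using induction with
  | one => simp
  | gen_mul u x ih =>
    by_cases hu : u ∈ P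
    · simp [hu]; omega
    · simp [hu]; omega

end proj

theorem isIndepSet_pair {u v : V} (h : ¬ Γ.Adj u v) : Γ.IsIndepSet {u, v} := by
  rintro x (rfl | rfl) y (rfl | rfl) hne
  · exact absurd rfl hne
  · exact h
  · exact fun h' => h h'.symm
  · exact absurd rfl hne

/-- Distinct generators commute only along edges. -/
theorem adj_of_gen_commute {u v : V} (hne : u ≠ v) (h : Commute (gen Γ u) (gen Γ v)) :
    Γ.Adj u v := by
  by_contra hn
  have := congrArg (fun x => (proj {u, v} (isIndepSet_pair hn) x).toList) h.eq
  simp at this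
  exact hne this.1

end RAArtinMonoid

/-! ### Induced subgraphs and direct decompositions -/

namespace RAArtinMonoid

variable {V : Type u} {Γ : SimpleGraph V}

/-- The inclusion of the monoid of an induced subgraph. -/
def incl (Γ : SimpleGraph V) (U : Set V) : RAArtinMonoid (Γ.induce U) →* RAArtinMonoid Γ :=
  lift (fun u => gen Γ u) fun _ _ h => gen_commute h

open Classical in
/-- The retraction onto the monoid of an induced subgraph that kills the other generators. -/
noncomputable def retract (Γ : SimpleGraph V) (U : Set V) :
    RAArtinMonoid Γ →* RAArtinMonoid (Γ.induce U) :=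
  lift (fun v => if h : v ∈ U then gen _ ⟨v, h⟩ else 1) fun u v h => by
    by_cases hu : u ∈ U <;> by_cases hv : v ∈ U
    · simpa [hu, hv] using gen_commute (Γ := Γ.induce U) (u := ⟨u, hu⟩) (v := ⟨v, hv⟩) h
    all_goals simp [hu, hv]

@[simp] theorem incl_gen {U : Set V} (u : U) : incl Γ U (gen _ u) = gen Γ u := by simp [incl]

@[simp] theorem retract_gen_of_mem {U : Set V} {v : V} (h : v ∈ U) :
    retract Γ U (gen Γ v) = gen _ ⟨v, h⟩ := by simp [retract, h]

@[simp] theorem retract_gen_of_notMem {U : Set V} {v : V} (h : v ∉ U) :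
    retract Γ U (gen Γ v) = 1 := by simp [retract, h]

theorem retract_eq_one {U : Set V} {x : RAArtinMonoid Γ} (h : ∀ v ∈ U, count x v = 0) :
    retract Γ U x = 1 := by
  induction x using induction with
  | one => simp
  | gen_mul v x ih =>
    have hv : v ∉ U := fun hv => by simpa using h v hv
    rw [map_mul, retract_gen_of_notMem hv, one_mul]
    exact ih fun w hw => by
      have := h w hw
      rw [count_mul] at this
      omega

@[simp] theorem retract_incl {U : Set V} (x : RAArtinMonoid (Γ.induce U)) :
    retract Γ U (incl Γ U x) = x := by
  induction x using induction with
  | one => simp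
  | gen_mul v x ih => rw [map_mul, map_mul, ih, incl_gen, retract_gen_of_mem v.2]

theorem retract_incl_of_disjoint {U W : Set V} (h : Disjoint U W)
    (x : RAArtinMonoid (Γ.induce W)) : retract Γ U (incl Γ W x) = 1 := by
  induction x using induction with
  | one => simp
  | gen_mul v x ih =>
    rw [map_mul, map_mul, ih, incl_gen, retract_gen_of_notMem (h.notMem_of_mem_right v.2), one_mul]

theorem commute_incl {U W : Set V} (h : ∀ u ∈ U, ∀ w ∈ W, Γ.Adj u w)
    (x : RAArtinMonoid (Γ.induce U)) (y : RAArtinMonoid (Γ.induce W)) :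
    Commute (incl Γ U x) (incl Γ W y) := by
  induction x using induction with
  | one => simp
  | gen_mul u x hx =>
    rw [map_mul]
    refine Commute.mul_left ?_ hx
    clear hx
    induction y using induction with
    | one => simp
    | gen_mul w y hy =>
      rw [map_mul]
      refine Commute.mul_right ?_ hy
      simpa using gen_commute (h u u.2 w w.2)

/-- If every vertex of `U` is adjacent to every other vertex, then `A_Γ⁺` is the direct product
of the monoids of the subgraphs induced on `U` and on its complement. -/
noncomputable def prodEquiv (U : Set V) (h : ∀ u ∈ U, ∀ w ∈ Uᶜ, Γ.Adj u w) :
    RAArtinMonoid Γ ≃* RAArtinMonoid (Γ.induce U) × RAArtinMonoid (Γ.induce Uᶜ) :=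
  MonoidHom.toMulEquiv ((retract Γ U).prod (retract Γ Uᶜ))
    ((incl Γ U).noncommCoprod (incl Γ Uᶜ) (commute_incl h))
    (by
      refine hom_ext fun v => ?_
      by_cases hv : v ∈ U
      · simp [hv]
      · simp [hv])
    (by
      refine MonoidHom.ext fun x => Prod.ext ?_ ?_
      · simp [retract_incl_of_disjoint disjoint_compl_right]
      · simp [retract_incl_of_disjoint disjoint_compl_left])

/-- Let `U` be joined to its complement by all possible edges. If the only letter of `x` in `U` is
`a`, then `x` splits as a power of `a` times an element supported outside `U`. -/
theorem exists_eq_gen_pow_mul {U : Set V} (h : ∀ u ∈ U, ∀ w ∈ Uᶜ, Γ.Adj u w) {a : V}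
    (ha : a ∈ U) {x : RAArtinMonoid Γ} (hx : ∀ v ∈ U, v ≠ a → count x v = 0) :
    ∃ k, x = gen Γ a ^ k * incl Γ Uᶜ (retract Γ Uᶜ x) := by
  induction x using induction with
  | one => exact ⟨0, by simp⟩
  | gen_mul v x ih =>
    obtain ⟨k, hk⟩ := ih fun w hw hne => by
      have := hx w hw hne
      rw [count_mul] at this
      omega
    by_cases hv : v ∈ U
    · have : v = a := by
        by_contra hne
        simpa using hx v hv hne
      subst this
      refine ⟨k + 1, ?_⟩
      conv_lhs => rw [hk]
      rw [map_mul, retract_gen_of_notMem (by simpa using hv), one_mul, pow_succ', mul_assoc]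
    · refine ⟨k, ?_⟩
      conv_lhs => rw [hk]
      rw [map_mul, retract_gen_of_mem (U := Uᶜ) hv, map_mul, incl_gen, ← mul_assoc, ← mul_assoc,
        ((gen_commute (h a ha v hv)).symm.pow_right k).eq]

/-- If `U` is joined to its complement by all possible edges, an element either starts with a
letter in `U` or commutes with all generators in `U`. -/
theorem exists_eq_gen_mul_or_commute {U : Set V} (h : ∀ u ∈ U, ∀ w ∈ Uᶜ, Γ.Adj u w)
    (x : RAArtinMonoid Γ) :
    (∃ v ∈ U, ∃ y, x = gen Γ v * y) ∨ ∀ v ∈ U, Commute x (gen Γ v) := by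
  induction x using induction with
  | one => exact .inr fun v _ => Commute.one_left _
  | gen_mul u x ih =>
    by_cases hu : u ∈ U
    · exact .inl ⟨u, hu, x, rfl⟩
    rcases ih with ⟨v, hv, y, rfl⟩ | ih
    · refine .inl ⟨v, hv, gen Γ u * y, ?_⟩
      rw [← mul_assoc, ← mul_assoc, (gen_commute (h v hv u hu)).eq]
    · exact .inr fun v hv => (gen_commute (h v hv u hu)).symm.mul_left (ih v hv)

/-- Distinct coconnected components are joined by all possible edges. -/
theorem adj_of_mem_supp_of_notMem_supp (C : CoconnectedComponent Γ) :
    ∀ u ∈ C.supp, ∀ w ∈ C.suppᶜ, Γ.Adj u w := by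
  intro u hu w hw
  by_contra hn
  have hne : u ≠ w := fun h => hw (h ▸ hu)
  exact hw (C.mem_supp_of_adj_mem_supp hu ((SimpleGraph.compl_adj _ _ _).2 ⟨hne, hn⟩))

/-! ### Blocking letters -/

/-- The element `s` blocks the letter `v` (at level `N`) if, for some letter `u` that does not
commute with `v`, the projection of `s` to words in `u` and `v` starts with `u ^ N`. An element of
length less than `N` that has a common right multiple with `s` then cannot contain `v`. -/
def Blocks (N : ℕ) (s : RAArtinMonoid Γ) (v : V) : Prop :=
  ∃ u, ∃ h : Γᶜ.Adj u v, ∃ z, proj {u, v} (isIndepSet_pair h.2) s = FreeMonoid.of u ^ N * z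

theorem toList_of_pow (u : V) (N : ℕ) :
    (FreeMonoid.of u ^ N).toList = List.replicate N u := by
  induction N with
  | zero => rfl
  | succ N ih => rw [pow_succ', FreeMonoid.toList_mul, ih, List.replicate_succ]; rfl

theorem Blocks.count_eq_zero {N : ℕ} {s f x y : RAArtinMonoid Γ} {v : V} (hs : Blocks N s v)
    (hf : length f < N) (h : f * x = s * y) : count f v = 0 := by
  obtain ⟨u, huv, z, hz⟩ := hs
  by_contra hne
  set π := proj {u, v} (isIndepSet_pair huv.2)
  have hl : (π f).toList ++ (π x).toList = List.replicate N u ++ (z * π y).toList := by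
    rw [← toList_of_pow, ← FreeMonoid.toList_mul, ← FreeMonoid.toList_mul, ← map_mul, h, map_mul,
      hz, mul_assoc]
  have hp : (π f).toList <+: List.replicate N u := by
    refine List.prefix_of_prefix_length_le (List.prefix_append _ (π x).toList)
      (by rw [hl]; exact List.prefix_append _ _) ?_
    rw [List.length_replicate]
    exact (length_proj_le f).trans hf.le
  have hv : v ∈ (π f).toList := mem_toList_proj.2 ⟨by simp, hne⟩
  exact huv.1 (List.eq_of_mem_replicate (hp.subset hv)).symm

theorem Blocks.mul_right {N : ℕ} {s : RAArtinMonoid Γ} {v : V} (hs : Blocks N s v)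
    (x : RAArtinMonoid Γ) : Blocks N (s * x) v := by
  obtain ⟨u, huv, z, hz⟩ := hs
  exact ⟨u, huv, z * proj _ _ x, by rw [map_mul, hz, mul_assoc]⟩

theorem Blocks.mul_left {N : ℕ} {s : RAArtinMonoid Γ} {v : V} (hs : Blocks N s v)
    {r : RAArtinMonoid Γ} (hr : ∀ w, Γᶜ.Reachable w v → count r w = 0) : Blocks N (r * s) v := by
  obtain ⟨u, huv, z, hz⟩ := hs
  refine ⟨u, huv, z, ?_⟩
  rw [map_mul, hz, proj_eq_one, one_mul]
  rintro w (rfl | rfl)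
  · exact hr _ huv.reachable
  · exact hr _ .rfl

/-- Starting from an element that blocks all letters of `T` outside `R`, a further letter adjacent
in `Γᶜ` to `u ∈ T` is blocked after multiplication by `u ^ N`; this reaches every vertex joined
to `T` by a path in `Γᶜ`. -/
theorem exists_blocks_insert (R : Set V) (N : ℕ) {T : Set V} {s : RAArtinMonoid Γ}
    (hT : ∀ v, count s v ≠ 0 → v ∈ T) (hs : ∀ v ∈ T, v ∉ R → Blocks N s v) {r v : V}
    (hr : r ∈ T) (hv : Γᶜ.Reachable r v) :
    ∃ (T' : Set V) (s' : RAArtinMonoid Γ), T ⊆ T' ∧ v ∈ T' ∧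
      (∀ w ∈ T', w ∈ T ∨ Γᶜ.Reachable r w) ∧
      (∀ w, count s' w ≠ 0 → w ∈ T') ∧ ∀ w ∈ T', w ∉ R → Blocks N s' w := by
  rw [SimpleGraph.reachable_iff_reflTransGen] at hv
  induction hv with
  | refl => exact ⟨T, s, subset_rfl, hr, fun w hw => .inl hw, hT, hs⟩
  | @tail u v hu huv ih =>
    obtain ⟨T', s', hTT', huT', hreach, hT', hs'⟩ := ih
    by_cases hv : v ∈ T'
    · exact ⟨T', s', hTT', hv, hreach, hT', hs'⟩
    refine ⟨insert v T', s' * gen Γ u ^ N, hTT'.trans (Set.subset_insert _ _),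
      Set.mem_insert _ _, ?_, ?_, ?_⟩
    · rintro w (rfl | hw)
      · exact .inr ((SimpleGraph.reachable_iff_reflTransGen _ _).2 (hu.tail huv))
      · exact hreach w hw
    · intro w hw
      by_cases hwu : w = u
      · exact hwu ▸ .inr huT'
      · exact .inr (hT' w (by simpa [Ne.symm hwu] using hw))
    · rintro w (rfl | hw) hwR
      · -- the letter `w = v` does not occur in `s'`, so both factors project to powers of `u`
        have hpow : ∀ y : RAArtinMonoid Γ, count y w = 0 →
            ∃ m, proj {u, w} (isIndepSet_pair huv.2) y = FreeMonoid.of u ^ m := by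
          intro y
          induction y using induction with
          | one => exact fun _ => ⟨0, by simp⟩
          | gen_mul t y ih =>
            intro hy
            rw [count_mul] at hy
            obtain ⟨m, hm⟩ := ih (by omega)
            have htw : t ≠ w := by
              rintro rfl
              simp at hy
            by_cases htu : t = u
            · subst htu
              exact ⟨m + 1, by rw [map_mul, hm, proj_gen_of_mem (by simp), pow_succ']⟩
            · exact ⟨m, by rw [map_mul, hm, proj_gen_of_notMem (by simp [htu, htw]), one_mul]⟩
        obtain ⟨m, hm⟩ := hpow s' (by_contra fun h => hv (hT' w h))
        refine ⟨u, huv, FreeMonoid.of u ^ m, ?_⟩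
        rw [map_mul, hm, map_pow, proj_gen_of_mem (by simp), ← pow_add, ← pow_add, add_comm]
      · exact (hs' w hw hwR).mul_right _

/-- Finitely many letters that can be reached from `R` in `Γᶜ` are blocked simultaneously, except
those in `R` itself. -/
theorem exists_forall_blocks (R : Set V) (N : ℕ) {W : Set V} (hW : W.Finite)
    (h : ∀ w ∈ W, ∃ r ∈ R, Γᶜ.Reachable r w) :
    ∃ s : RAArtinMonoid Γ, (∀ v, count s v ≠ 0 → ∃ r ∈ R, Γᶜ.Reachable r v) ∧
      ∀ v ∈ W, v ∉ R → Blocks N s v := by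
  suffices ∃ (T : Set V) (s : RAArtinMonoid Γ), R ⊆ T ∧ W ⊆ T ∧
      (∀ w ∈ T, ∃ r ∈ R, Γᶜ.Reachable r w) ∧
      (∀ w, count s w ≠ 0 → w ∈ T) ∧ ∀ w ∈ T, w ∉ R → Blocks N s w by
    obtain ⟨T, s, -, hWT, hreach, hT, hs⟩ := this
    exact ⟨s, fun v hv => hreach v (hT v hv), fun v hv => hs v (hWT hv)⟩
  induction W, hW using Set.Finite.induction_on with
  | empty =>
    exact ⟨R, 1, subset_rfl, Set.empty_subset _, fun w hw => ⟨w, hw, .rfl⟩, by simp,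
      fun w hw hw' => absurd hw hw'⟩
  | @insert w W _ _ ih =>
    obtain ⟨T, s, hRT, hWT, hreach, hT, hs⟩ := ih fun x hx => h x (.inr hx)
    obtain ⟨r, hr, hrw⟩ := h w (.inl rfl)
    obtain ⟨T', s', hTT', hw, hreach', hT', hs'⟩ := exists_blocks_insert R N hT hs (hRT hr) hrw
    refine ⟨T', s', hRT.trans hTT', Set.insert_subset hw (hWT.trans hTT'), fun x hx => ?_, hT', hs'⟩
    exact (hreach' x hx).elim (hreach x) fun hx => ⟨r, hr, hx⟩

end RAArtinMonoid

/-! ### Failure of accurate refinement -/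

theorem not_monoidOrthogonal_iff {S : Type u} [Monoid S] {s t : S} :
    ¬ MonoidOrthogonal s t ↔ ∃ x y, s * x = t * y := by
  simp only [MonoidOrthogonal, Set.eq_empty_iff_forall_notMem, Set.mem_inter_iff, Set.mem_range]
  push Not
  exact ⟨fun ⟨_, ⟨x, hx⟩, y, hy⟩ => ⟨x, y, hx.trans hy.symm⟩,
    fun ⟨x, y, h⟩ => ⟨_, ⟨x, rfl⟩, y, h.symm⟩⟩

/-- Passing to right multiples, a given finite set can be separated into left divisors of one
element `t` and elements orthogonal to it. -/
theorem exists_forall_dvd_or_monoidOrthogonal {S : Type u} [Monoid S] {G : Set S}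
    (hG : G.Finite) : ∃ t : S, ∀ g ∈ G, (∃ y, t = g * y) ∨ MonoidOrthogonal g t := by
  induction G, hG using Set.Finite.induction_on with
  | empty => exact ⟨1, by simp⟩
  | @insert g G _ _ ih =>
    obtain ⟨t, ht⟩ := ih
    have key : ∀ x, ∀ f ∈ G, (∃ y, t * x = f * y) ∨ MonoidOrthogonal f (t * x) := by
      intro x f hf
      rcases ht f hf with ⟨y, rfl⟩ | h
      · exact .inl ⟨y * x, mul_assoc _ _ _⟩
      · refine .inr (by_contra fun hn => ?_)
        obtain ⟨a, b, hab⟩ := not_monoidOrthogonal_iff.1 hn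
        exact not_monoidOrthogonal_iff.2 ⟨a, x * b, by rw [hab, mul_assoc]⟩ h
    by_cases h : MonoidOrthogonal g t
    · refine ⟨t, ?_⟩
      rintro f (rfl | hf)
      · exact .inr h
      · simpa using key 1 f hf
    · obtain ⟨x, y, hxy⟩ := not_monoidOrthogonal_iff.1 h
      refine ⟨t * y, ?_⟩
      rintro f (rfl | hf)
      · exact .inl ⟨x, hxy.symm⟩
      · exact key y f hf

namespace RAArtinMonoid

variable {V : Type u} {Γ : SimpleGraph V}

/-- Let `F'` be a foundation set and let `t` be supported outside a finite component `C` and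
separate the parts of `F'` outside `C`. A vertex `a` of `C` gives an element of `F'` of the form
`a ^ k * g` with `g` a left divisor of `t`. -/
theorem exists_mem_eq_gen_pow_mul {C : CoconnectedComponent Γ} (hC : C.supp.Finite) {a : V}
    (ha : a ∈ C.supp) {F' : Set (RAArtinMonoid Γ)} (hF' : IsFoundationSet F')
    {t : RAArtinMonoid (Γ.induce C.suppᶜ)}
    (ht : ∀ f ∈ F', (∃ y, t = retract Γ C.suppᶜ f * y) ∨
      MonoidOrthogonal (retract Γ C.suppᶜ f) t) :
    ∃ f ∈ F', (∀ v ∈ C.supp, v ≠ a → count f v = 0) ∧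
      ∃ k y, f = gen Γ a ^ k * incl Γ C.suppᶜ (retract Γ C.suppᶜ f) ∧
        t = retract Γ C.suppᶜ f * y := by
  obtain ⟨N, hN⟩ : ∃ N, ∀ f ∈ F', length f < N := by
    obtain ⟨N, hN⟩ := (hF'.1.image length).bddAbove
    exact ⟨N + 1, fun f hf => Nat.lt_succ_of_le (hN ⟨f, hf, rfl⟩)⟩
  have hreach : ∀ w, w ∈ C.supp ↔ Γᶜ.Reachable a w := by
    intro w
    rw [SimpleGraph.ConnectedComponent.mem_supp_iff] at ha ⊢
    rw [← ha, eq_comm, SimpleGraph.ConnectedComponent.eq]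
  obtain ⟨p, hpC, hp⟩ := exists_forall_blocks (Γ := Γ) {a} N hC fun w hw =>
    ⟨a, rfl, (hreach w).1 hw⟩
  obtain ⟨f, hf, hfs⟩ := hF'.2 (p * incl Γ C.suppᶜ t)
  obtain ⟨x, y, hxy⟩ := not_monoidOrthogonal_iff.1 hfs
  have hcount : ∀ v ∈ C.supp, v ≠ a → count f v = 0 := fun v hv hva =>
    ((hp v hv (by simpa using hva)).mul_right _).count_eq_zero (hN f hf) hxy
  obtain ⟨k, hk⟩ := exists_eq_gen_pow_mul (adj_of_mem_supp_of_notMem_supp C) ha hcount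
  have hp1 : retract Γ C.suppᶜ p = 1 := retract_eq_one fun v hv => by
    by_contra hne
    obtain ⟨r, rfl, hr⟩ := hpC v hne
    exact hv ((hreach v).2 hr)
  have hnot : ¬ MonoidOrthogonal (retract Γ C.suppᶜ f) t := by
    refine not_monoidOrthogonal_iff.2 ⟨retract _ _ x, retract _ _ y, ?_⟩
    rw [← map_mul, hxy, map_mul, map_mul, hp1, retract_incl, one_mul]
  obtain ⟨y, hy⟩ := (ht f hf).resolve_right hnot
  exact ⟨f, hf, hcount, k, y, hk, hy⟩

/-- The generators of a finite component `C` form a foundation set. If `C` has an edge `ab`, an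
accurate refinement would contain elements `a ^ k * g` and `b ^ l * h` with a common right
multiple; these would coincide and hence contain no letter of `C` at all. -/
theorem graph_eq_bot_of_hasPropertyAR (h : HasPropertyAR (RAArtinMonoid Γ))
    (C : CoconnectedComponent Γ) (hC : C.supp.Finite) : C.graph = ⊥ := by
  by_contra hne
  obtain ⟨⟨a, ha⟩, ⟨b, hb⟩, hab⟩ := SimpleGraph.ne_bot_iff_exists_adj.1 hne
  replace hab : Γ.Adj a b := hab
  have hadj := adj_of_mem_supp_of_notMem_supp C
  obtain ⟨F', hF', hacc, href⟩ := h (gen Γ '' C.supp) ⟨hC.image _, fun s => by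
    rcases exists_eq_gen_mul_or_commute hadj s with ⟨v, hv, y, rfl⟩ | hs
    · exact ⟨_, ⟨v, hv, rfl⟩, not_monoidOrthogonal_iff.2 ⟨y, 1, by simp⟩⟩
    · exact ⟨_, ⟨a, ha, rfl⟩, not_monoidOrthogonal_iff.2 ⟨s, gen Γ a, (hs a ha).symm⟩⟩⟩
  obtain ⟨t, ht⟩ := exists_forall_dvd_or_monoidOrthogonal (hF'.1.image (retract Γ C.suppᶜ))
  rw [Set.forall_mem_image] at ht
  obtain ⟨f, hf, hfa, k, y, hfk, hfy⟩ := exists_mem_eq_gen_pow_mul hC ha hF' ht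
  obtain ⟨g, hg, hgb, l, z, hgl, hgz⟩ := exists_mem_eq_gen_pow_mul hC hb hF' ht
  have hcomm : ∀ c ∈ C.supp, ∀ n x, Commute (gen Γ c ^ n) (incl Γ C.suppᶜ x) := by
    intro c hc n x
    simpa using commute_incl hadj (gen _ ⟨c, hc⟩ ^ n) x
  have hfg : f = g := by
    by_contra hne
    refine not_monoidOrthogonal_iff.2
      ⟨gen Γ b ^ l * incl Γ _ y, gen Γ a ^ k * incl Γ _ z, ?_⟩ (hacc f hf g hg hne)
    rw [hfk, hgl, mul_assoc, ← mul_assoc (incl _ _ _), ← (hcomm b hb l _).eq, mul_assoc,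
      ← map_mul, ← hfy, mul_assoc, ← mul_assoc (incl _ _ _) (gen Γ a ^ k), ← (hcomm a ha k _).eq,
      mul_assoc, ← map_mul, ← hgz, ← mul_assoc, ← mul_assoc,
      ((gen_commute hab).pow_pow k l).eq]
  subst hfg
  obtain ⟨_, ⟨v, hv, rfl⟩, x, rfl⟩ := href f hf
  have hva : v = a := by_contra fun hne => by simpa using hfa v hv hne
  have hvb : v = b := by_contra fun hne => by simpa using hgb v hv hne
  exact hab.ne (hva.symm.trans hvb)

end RAArtinMonoid

/-! ### Accurate refinement by words of equal length -/

namespace RAArtinMonoid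

variable {V : Type u} {Γ : SimpleGraph V}

theorem isIndepSet_supp {C : CoconnectedComponent Γ} (h : C.graph = ⊥) : Γ.IsIndepSet C.supp := by
  intro u hu v hv _ huv
  have : C.graph.Adj ⟨u, hu⟩ ⟨v, hv⟩ := huv
  rw [h] at this
  exact this

/-- For an edge-free component, a first letter of the projection can be moved to the front. -/
theorem exists_eq_gen_mul_of_proj_eq {C : CoconnectedComponent Γ} {hC : Γ.IsIndepSet C.supp}
    {s : RAArtinMonoid Γ} {v : V} {w : FreeMonoid V}
    (h : proj C.supp hC s = FreeMonoid.of v * w) : ∃ y, s = gen Γ v * y := by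
  have hv : v ∈ C.supp :=
    (mem_toList_proj (hP := hC) (x := s)).1 (by rw [h]; simp) |>.1
  induction s using induction with
  | one => simpa using congrArg FreeMonoid.toList h
  | gen_mul u s ih =>
    by_cases hu : u ∈ C.supp
    · rw [map_mul, proj_gen_of_mem hu] at h
      have := congrArg FreeMonoid.toList h
      simp only [FreeMonoid.toList_mul, FreeMonoid.toList_of, List.singleton_append,
        List.cons.injEq] at this
      exact ⟨s, by rw [this.1]⟩
    · rw [map_mul, proj_gen_of_notMem hu, one_mul] at h
      obtain ⟨y, rfl⟩ := ih h
      refine ⟨gen Γ u * y, ?_⟩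
      rw [← mul_assoc, ← mul_assoc, (gen_commute (adj_of_mem_supp_of_notMem_supp C v hv u hu)).eq]

section

variable {J : Set (CoconnectedComponent Γ)} (hJ : ∀ C ∈ J, Γ.IsIndepSet C.supp)

/-- On the part of `A_Γ⁺` spanned by edge-free components, left divisibility is detected by the
projections to the free monoids of these components. -/
theorem exists_eq_mul_of_proj_eq_mul {f s : RAArtinMonoid Γ}
    (hf : ∀ v, count f v ≠ 0 → Γᶜ.connectedComponentMk v ∈ J)
    (h : ∀ C (hC : C ∈ J), ∃ z, proj C.supp (hJ C hC) s = proj C.supp (hJ C hC) f * z) :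
    ∃ y, s = f * y := by
  induction f using induction generalizing s with
  | one => exact ⟨s, (one_mul s).symm⟩
  | gen_mul v f ih =>
    have hv := hf v (by simp)
    have hvC : v ∈ (Γᶜ.connectedComponentMk v).supp := rfl
    obtain ⟨z, hz⟩ := h _ hv
    rw [map_mul, proj_gen_of_mem hvC, mul_assoc] at hz
    obtain ⟨s, rfl⟩ := exists_eq_gen_mul_of_proj_eq hz
    obtain ⟨y, rfl⟩ := ih (s := s) (fun w hw => hf w (by rw [count_mul]; omega)) fun C hC => by
      obtain ⟨z, hz⟩ := h C hC
      refine ⟨z, ?_⟩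
      by_cases hvC : v ∈ C.supp
      · rw [map_mul, map_mul, proj_gen_of_mem hvC, mul_assoc] at hz
        exact mul_left_cancel hz
      · rwa [map_mul, map_mul, proj_gen_of_notMem hvC, one_mul, one_mul] at hz
    exact ⟨y, (mul_assoc _ _ _).symm⟩

/-- The elements supported on the components in `J` all of whose projections to these components
have length `N`. -/
def balanced (N : ℕ) : Set (RAArtinMonoid Γ) :=
  {s | (∀ v, count s v ≠ 0 → Γᶜ.connectedComponentMk v ∈ J) ∧
    ∀ C (hC : C ∈ J), (proj C.supp (hJ C hC) s).toList.length = N}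

variable {hJ}

theorem eq_of_mem_balanced {N : ℕ} {s t : RAArtinMonoid Γ} (hs : s ∈ balanced hJ N)
    (ht : t ∈ balanced hJ N)
    (h : ∀ C (hC : C ∈ J), proj C.supp (hJ C hC) s = proj C.supp (hJ C hC) t) : s = t := by
  obtain ⟨y, rfl⟩ := exists_eq_mul_of_proj_eq_mul hJ hs.1 (s := t)
    fun C hC => ⟨1, by rw [h C hC, mul_one]⟩
  suffices y = 1 by rw [this, mul_one]
  refine eq_one_of_count_eq_zero fun v => by_contra fun hv => ?_
  have hvJ := ht.1 v (by rw [count_mul]; omega)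
  have hy : proj _ (hJ _ hvJ) y = 1 := by
    have := h _ hvJ
    rw [map_mul] at this
    exact (mul_eq_left.1 this.symm)
  have hmem := (mem_toList_proj (hP := hJ _ hvJ)).2
    ⟨(rfl : v ∈ (Γᶜ.connectedComponentMk v).supp), hv⟩
  rw [hy] at hmem
  simp at hmem

theorem isAccurate_balanced (N : ℕ) : IsAccurate (balanced hJ N) := by
  intro f hf g hg hne
  by_contra hn
  obtain ⟨x, y, hxy⟩ := not_monoidOrthogonal_iff.1 hn
  refine hne (eq_of_mem_balanced hf hg fun C hC => ?_)
  have := congrArg (fun x => (proj C.supp (hJ C hC) x).toList) hxy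
  simp only [map_mul, FreeMonoid.toList_mul] at this
  exact FreeMonoid.toList.injective
    (List.append_inj_left this ((hf.2 C hC).trans (hg.2 C hC).symm))

theorem finite_balanced (hfin : J.Finite) (hsupp : ∀ C ∈ J, C.supp.Finite) (N : ℕ) :
    (balanced hJ N).Finite := by
  have : Finite J := hfin
  have hwords : ∀ C : J, {l : List V | l.length = N ∧ ∀ v ∈ l, v ∈ C.1.supp}.Finite := by
    intro C
    have : Finite C.1.supp := hsupp C C.2
    refine ((List.finite_length_eq C.1.supp N).image (List.map Subtype.val)).subset ?_
    rintro l ⟨hl, hmem⟩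
    lift l to List C.1.supp using hmem
    exact ⟨l, by simpa using hl, rfl⟩
  refine Set.Finite.of_injOn (f := fun s (C : J) => (proj C.1.supp (hJ C C.2) s).toList)
    ?_ ?_ (Set.Finite.pi' hwords)
  · exact fun s hs C => ⟨hs.2 C C.2, fun v hv => (mem_toList_proj.1 hv).1⟩
  · exact fun s hs t ht h => eq_of_mem_balanced hs ht fun C hC =>
      FreeMonoid.toList.injective (congrFun h ⟨C, hC⟩)

/-- An element with sufficiently long projections has a left divisor all of whose projections have
length exactly `N`: extend a divisor letter by letter. -/
theorem exists_mem_balanced_eq_mul {N : ℕ} {s : RAArtinMonoid Γ}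
    (hs : ∀ C (hC : C ∈ J), N ≤ (proj C.supp (hJ C hC) s).toList.length) :
    ∃ f ∈ balanced hJ N, ∃ y, s = f * y := by
  by_contra hno
  have key : ∀ n : ℕ, ∃ f y, s = f * y ∧ length f = n ∧
      (∀ v, count f v ≠ 0 → Γᶜ.connectedComponentMk v ∈ J) ∧
      ∀ C (hC : C ∈ J), (proj C.supp (hJ C hC) f).toList.length ≤ N := by
    intro n
    induction n with
    | zero => exact ⟨1, s, by simp⟩
    | succ n ih =>
      obtain ⟨f, y, rfl, hlen, hf, hN⟩ := ih
      obtain ⟨C, hC, hlt⟩ : ∃ C, ∃ hC : C ∈ J, (proj C.supp (hJ C hC) f).toList.length < N := by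
        by_contra! hge
        exact hno ⟨f, ⟨hf, fun C hC => (hN C hC).antisymm (hge C hC)⟩, y, rfl⟩
      obtain ⟨v, w, hvw⟩ : ∃ v w, proj C.supp (hJ C hC) y = FreeMonoid.of v * w := by
        rcases hy : (proj C.supp (hJ C hC) y).toList with _ | ⟨v, w⟩
        · have := hs C hC
          rw [map_mul, FreeMonoid.toList_mul, hy, List.append_nil] at this
          omega
        · exact ⟨v, FreeMonoid.ofList w, FreeMonoid.toList.injective hy⟩
      have hv : v ∈ C.supp :=
        (mem_toList_proj (hP := hJ C hC) (x := y)).1 (by rw [hvw]; simp) |>.1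
      obtain ⟨y, rfl⟩ := exists_eq_gen_mul_of_proj_eq hvw
      refine ⟨f * gen Γ v, y, (mul_assoc _ _ _).symm, by simp [hlen], fun u hu => ?_,
        fun D hD => ?_⟩
      · by_cases huv : v = u
        · subst huv
          rw [SimpleGraph.ConnectedComponent.mem_supp_iff] at hv
          exact hv ▸ hC
        · exact hf u (by simpa [huv] using hu)
      · by_cases hvD : v ∈ D.supp
        · have hCD : C = D := by
            rw [SimpleGraph.ConnectedComponent.mem_supp_iff] at hv hvD
            exact hv.symm.trans hvD
          subst hCD
          rw [map_mul, proj_gen_of_mem hvD, FreeMonoid.toList_mul, List.length_append]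
          simpa using hlt
        · rw [map_mul, proj_gen_of_notMem hvD, mul_one]
          exact hN D hD
  obtain ⟨f, y, hfy, hlen, -⟩ := key (length s + 1)
  have := congrArg length hfy
  rw [length_mul] at this
  omega

theorem exists_le_length_proj (hfin : J.Finite) (N : ℕ) : ∃ z : RAArtinMonoid Γ,
    ∀ C ∈ J, ∀ hC : Γ.IsIndepSet C.supp, N ≤ (proj C.supp hC z).toList.length := by
  induction J, hfin using Set.Finite.induction_on with
  | empty => exact ⟨1, by simp⟩
  | @insert C J _ _ ih =>
    obtain ⟨z, hz⟩ := ih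
    obtain ⟨c, hc⟩ := C.nonempty_supp
    refine ⟨z * gen Γ c ^ N, ?_⟩
    rintro D (rfl | hD) hind
    · rw [map_mul, map_pow, proj_gen_of_mem hc, FreeMonoid.toList_mul, toList_of_pow]
      simp
    · rw [map_mul, FreeMonoid.toList_mul, List.length_append]
      exact (hz D hD hind).trans (Nat.le_add_right _ _)

end

/-- Let `J` be the set of finite components that contain letters of the foundation set `F`. An
element of `F` with a common right multiple with `s * p`, where `s` is supported on `J` and `p`
blocks all letters of `F` in infinite components, is itself supported on `J`. Hence the balanced
elements of sufficient length lie in `F A_Γ⁺`. -/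
theorem hasPropertyAR_of_graph_eq_bot
    (h : ∀ C : CoconnectedComponent Γ, C.supp.Finite → C.graph = ⊥) :
    HasPropertyAR (RAArtinMonoid Γ) := by
  intro F hF
  obtain ⟨N, hN⟩ : ∃ N, ∀ f ∈ F, length f < N := by
    obtain ⟨N, hN⟩ := (hF.1.image length).bddAbove
    exact ⟨N + 1, fun f hf => Nat.lt_succ_of_le (hN ⟨f, hf, rfl⟩)⟩
  obtain ⟨K, hK, hFK⟩ : ∃ K : Set V, K.Finite ∧ ∀ f ∈ F, ∀ v, count f v ≠ 0 → v ∈ K :=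
    ⟨_, hF.1.biUnion fun f _ => finite_count_ne_zero f, fun f hf v hv =>
      Set.mem_biUnion hf hv⟩
  let comp : V → CoconnectedComponent Γ := Γᶜ.connectedComponentMk
  set J : Set (CoconnectedComponent Γ) := {C | C.supp.Finite ∧ C ∈ comp '' K}
  have hJ : ∀ C ∈ J, Γ.IsIndepSet C.supp := fun C hC => isIndepSet_supp (h C hC.1)
  have hJfin : J.Finite := (hK.image comp).subset fun C hC => hC.2
  refine ⟨balanced hJ N, ⟨finite_balanced hJfin (fun C hC => hC.1) N, fun s => ?_⟩,
    isAccurate_balanced N, fun s hs => ?_⟩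
  · obtain ⟨z, hz⟩ := exists_le_length_proj hJfin N
    obtain ⟨f, hf, y, hy⟩ := exists_mem_balanced_eq_mul (hJ := hJ) (N := N) (s := s * z)
      fun C hC => by
        rw [map_mul, FreeMonoid.toList_mul, List.length_append]
        exact (hz C hC _).trans (Nat.le_add_left _ _)
    exact ⟨f, hf, not_monoidOrthogonal_iff.2 ⟨y, z, hy.symm⟩⟩
  -- an infinite component has a letter outside `K` from which the letters in `K` can be reached
  obtain ⟨p, hpR, hp⟩ := exists_forall_blocks (Γ := Γ) {v | v ∉ K ∧ (comp v).supp.Infinite} N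
    (W := {v | v ∈ K ∧ (comp v).supp.Infinite}) (hK.subset fun v hv => hv.1) (by
      rintro w ⟨-, hw⟩
      obtain ⟨r, hr, hrK⟩ := hw.exists_notMem_finite hK
      replace hr : comp r = comp w := hr
      exact ⟨r, ⟨hrK, by rw [hr]; exact hw⟩, SimpleGraph.ConnectedComponent.exact hr⟩)
  have hpfin : ∀ v, (comp v).supp.Finite → count p v = 0 := by
    intro v hv
    by_contra hne
    obtain ⟨r, ⟨-, hr⟩, hrv⟩ := hpR v hne
    have : comp r = comp v := SimpleGraph.ConnectedComponent.sound hrv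
    exact hr (by rw [this]; exact hv)
  obtain ⟨f, hf, hfs⟩ := hF.2 (s * p)
  obtain ⟨x, y, hxy⟩ := not_monoidOrthogonal_iff.1 hfs
  refine ⟨f, hf, exists_eq_mul_of_proj_eq_mul hJ (fun v hv => ?_) fun C hC => ?_⟩
  · refine ⟨by_contra fun hinf => hv ?_, v, hFK f hf v hv, rfl⟩
    have hvK := hFK f hf v hv
    refine ((hp v ⟨hvK, hinf⟩ fun h => h.1 hvK).mul_left fun w hw => ?_).count_eq_zero
      (hN f hf) hxy
    by_contra hne
    have : comp w = comp v := SimpleGraph.ConnectedComponent.sound hw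
    exact hinf (show (comp v).supp.Finite by rw [← this]; exact (hs.1 w hne).1)
  · have hp1 : proj C.supp (hJ C hC) p = 1 := proj_eq_one fun v hv => hpfin v <| by
      replace hv : comp v = C := hv
      rw [hv]
      exact hC.1
    have := congrArg (fun x => (proj C.supp (hJ C hC) x).toList) hxy
    simp only [map_mul, FreeMonoid.toList_mul, hp1, FreeMonoid.toList_one, List.append_nil] at this
    obtain ⟨l, hl⟩ := List.prefix_of_prefix_length_le
      (List.prefix_append _ (proj C.supp (hJ C hC) x).toList)
      (by rw [this]; exact List.prefix_append _ _)
      ((length_proj_le f).trans ((hN f hf).le.trans (hs.2 C hC).ge))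
    exact ⟨FreeMonoid.ofList l, FreeMonoid.toList.injective hl.symm⟩

end RAArtinMonoid

/-! ### Direct summands and free monoids -/

namespace RAArtinMonoid

variable {V : Type u} {Γ : SimpleGraph V}

theorem finite_of_fg (h : Monoid.FG (RAArtinMonoid Γ)) : Finite V := by
  obtain ⟨S, hS, hfin⟩ := Submonoid.fg_iff _ |>.1 h.fg_top
  let T : Set V := ⋃ s ∈ S, {v | count s v ≠ 0}
  have hT : T.Finite := hfin.biUnion fun s _ => finite_count_ne_zero s
  have key : ∀ x ∈ Submonoid.closure S, ∀ v, count x v ≠ 0 → v ∈ T := by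
    intro x hx
    induction hx using Submonoid.closure_induction with
    | mem s hs => exact fun v hv => Set.mem_biUnion hs hv
    | one => simp
    | mul x y _ _ hx hy =>
      intro v hv
      by_cases h0 : count x v = 0
      · exact hy v (by simpa [h0] using hv)
      · exact hx v h0
  exact Set.finite_univ_iff.1
    (hT.subset fun v _ => key (gen Γ v) (by rw [hS]; trivial) v (by simp))

theorem fg_of_finite [Finite V] : Monoid.FG (RAArtinMonoid Γ) :=
  ⟨Submonoid.fg_iff _ |>.2 ⟨_, closure_range_gen, Set.finite_range _⟩⟩

theorem isFreeMonoid_of_eq_bot (h : Γ = ⊥) : IsFreeMonoid (RAArtinMonoid Γ) := by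
  refine ⟨V, ⟨MonoidHom.toMulEquiv (lift FreeMonoid.of fun u v huv => ?_)
    (FreeMonoid.lift (gen Γ)) (hom_ext fun v => by simp) (FreeMonoid.hom_eq fun v => by simp)⟩⟩
  rw [h] at huv
  exact huv.elim

/-- Atoms correspond to letters in a free monoid, where distinct letters do not commute. -/
theorem eq_bot_of_isFreeMonoid (h : IsFreeMonoid (RAArtinMonoid Γ)) : Γ = ⊥ := by
  obtain ⟨α, ⟨e⟩⟩ := h
  have hatom : ∀ v, ∃ a, e (gen Γ v) = FreeMonoid.of a := by
    intro v
    rcases hw : (e (gen Γ v)).toList with _ | ⟨a, w⟩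
    · have : e (gen Γ v) = 1 := FreeMonoid.toList.injective hw
      exact absurd ((map_eq_one_iff e e.injective).1 this) (gen_ne_one v)
    · have hw' : e (gen Γ v) = FreeMonoid.of a * FreeMonoid.ofList w :=
        FreeMonoid.toList.injective hw
      have hmul : e.symm (FreeMonoid.of a) * e.symm (FreeMonoid.ofList w) = gen Γ v := by
        rw [← map_mul, ← hw', e.symm_apply_apply]
      rcases eq_one_or_eq_one_of_mul_eq_gen hmul with h1 | h1
      · exact absurd ((map_eq_one_iff e.symm e.symm.injective).1 h1) (FreeMonoid.of_ne_one a)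
      · rw [(map_eq_one_iff e.symm e.symm.injective).1 h1, mul_one] at hw'
        exact ⟨a, hw'⟩
  by_contra hne
  obtain ⟨u, v, huv⟩ := SimpleGraph.ne_bot_iff_exists_adj.1 hne
  obtain ⟨a, ha⟩ := hatom u
  obtain ⟨b, hb⟩ := hatom v
  have hcomm := congrArg e (gen_commute huv).eq
  rw [map_mul, map_mul, ha, hb] at hcomm
  have hab : a = b := by
    have := congrArg FreeMonoid.toList hcomm
    simp only [FreeMonoid.toList_mul, FreeMonoid.toList_of, List.singleton_append,
      List.cons.injEq] at this
    exact this.1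
  exact huv.ne (gen_injective (e.injective (by rw [ha, hb, hab])))

section Decomposition

variable {M N : Type*} [Monoid M] [Monoid N] (e : RAArtinMonoid Γ ≃* M × N)

/-- An isomorphism to a direct product sends each atom to one of the factors. -/
theorem fst_eq_one_or_snd_eq_one (v : V) : (e (gen Γ v)).1 = 1 ∨ (e (gen Γ v)).2 = 1 := by
  have hmul : e.symm ((e (gen Γ v)).1, 1) * e.symm (1, (e (gen Γ v)).2) = gen Γ v := by
    rw [← map_mul]
    simp
  refine (eq_one_or_eq_one_of_mul_eq_gen hmul).imp (fun h => ?_) fun h => ?_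
  · exact congrArg Prod.fst ((map_eq_one_iff e.symm e.symm.injective).1 h)
  · exact congrArg Prod.snd ((map_eq_one_iff e.symm e.symm.injective).1 h)

/-- Vertices whose atoms lie in different factors are adjacent in `Γ`; so vertices adjacent in
`Γᶜ` belong to the same factor. -/
theorem snd_eq_one_of_compl_adj {u v : V} (h : Γᶜ.Adj u v) (hu : (e (gen Γ u)).2 = 1) :
    (e (gen Γ v)).2 = 1 := by
  refine (fst_eq_one_or_snd_eq_one e v).resolve_left fun hv => h.2 (adj_of_gen_commute h.1 ?_)
  apply e.injective
  rw [map_mul, map_mul]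
  ext <;> simp [hu, hv]

theorem snd_eq_one_of_reachable {u v : V} (h : Γᶜ.Reachable u v) (hu : (e (gen Γ u)).2 = 1) :
    (e (gen Γ v)).2 = 1 := by
  rw [SimpleGraph.reachable_iff_reflTransGen] at h
  induction h with
  | refl => exact hu
  | tail _ h ih => exact snd_eq_one_of_compl_adj e h ih

theorem subsingleton_right_of_forall (h : ∀ v, (e (gen Γ v)).2 = 1) : Subsingleton N := by
  have h1 : (MonoidHom.snd M N).comp e.toMonoidHom = 1 := hom_ext h
  have : ∀ n : N, n = 1 := fun n => by
    simpa using DFunLike.congr_fun h1 (e.symm (1, n))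
  exact ⟨fun a b => (this a).trans (this b).symm⟩

/-- The first factor is the monoid of the subgraph induced on those vertices whose atoms it
contains. -/
noncomputable def fstEquiv :
    M ≃* RAArtinMonoid (Γ.induce {v | (e (gen Γ v)).2 = 1}) :=
  MonoidHom.toMulEquiv
    ((retract Γ _).comp (e.symm.toMonoidHom.comp (MonoidHom.inl M N)))
    ((MonoidHom.fst M N).comp (e.toMonoidHom.comp (incl Γ _)))
    (by
      have key : ((MonoidHom.fst M N).comp (e.toMonoidHom.comp
          ((incl Γ {v | (e (gen Γ v)).2 = 1}).comp (retract Γ {v | (e (gen Γ v)).2 = 1})))) =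
          (MonoidHom.fst M N).comp e.toMonoidHom := hom_ext fun v => by
        by_cases hv : v ∈ {v | (e (gen Γ v)).2 = 1}
        · simp only [MonoidHom.comp_apply, retract_gen_of_mem hv, incl_gen]
        · have h1 := (fst_eq_one_or_snd_eq_one e v).resolve_right hv
          simp only [MonoidHom.comp_apply, retract_gen_of_notMem hv, map_one]
          exact h1.symm
      ext m
      simpa using DFunLike.congr_fun key (e.symm (m, 1)))
    (hom_ext fun v => by
      have hv : e.symm ((e (gen Γ v.1)).1, 1) = gen Γ v.1 := by
        rw [MulEquiv.symm_apply_eq]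
        exact Prod.ext rfl v.2.symm
      simp [hv])

end Decomposition

theorem nontrivial [Nonempty V] : Nontrivial (RAArtinMonoid Γ) :=
  ⟨gen Γ (Classical.arbitrary V), 1, gen_ne_one _⟩

/-- The summands belonging to coconnected components are directly indecomposable. -/
theorem isDirectlyIndecomposable (C : CoconnectedComponent Γ) :
    IsDirectlyIndecomposable (RAArtinMonoid C.graph) := by
  have : Nonempty C.supp := C.nonempty_supp.to_subtype
  refine ⟨nontrivial, fun N P _ _ ⟨e⟩ => ?_⟩
  have hconn : ∀ u v, C.graphᶜ.Reachable u v := by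
    have heq : C.graphᶜ = C.toSimpleGraph := by
      ext u v
      simp [SimpleGraph.ConnectedComponent.toSimpleGraph, Subtype.ext_iff]
    rw [heq]
    exact C.connected_toSimpleGraph.preconnected
  obtain ⟨u⟩ := this
  rcases fst_eq_one_or_snd_eq_one e u with h | h
  · exact .inl <| subsingleton_right_of_forall (e.trans MulEquiv.prodComm) fun v =>
      snd_eq_one_of_reachable (e.trans MulEquiv.prodComm) (hconn u v) h
  · exact .inr <| subsingleton_right_of_forall e fun v => snd_eq_one_of_reachable e (hconn u v) h

theorem isDirectSummand (C : CoconnectedComponent Γ) :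
    IsDirectSummand (RAArtinMonoid C.graph) (RAArtinMonoid Γ) :=
  ⟨_, _, ⟨prodEquiv C.supp (adj_of_mem_supp_of_notMem_supp C)⟩⟩

/-- Conversely, every directly indecomposable summand belongs to a coconnected component. -/
theorem exists_mulEquiv_of_isDirectSummand {M : Type u} [Monoid M]
    (hM : IsDirectSummand M (RAArtinMonoid Γ)) (hind : IsDirectlyIndecomposable M) :
    ∃ C : CoconnectedComponent Γ, Nonempty (M ≃* RAArtinMonoid C.graph) := by
  obtain ⟨N, _, ⟨e⟩⟩ := hM
  let φ := fstEquiv e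
  obtain ⟨U, hU⟩ : ∃ U, U = {v | (e (gen Γ v)).2 = 1} := ⟨_, rfl⟩
  have hreach : ∀ u v, Γᶜ.Reachable u v → u ∈ U → v ∈ U := by
    rw [hU]
    exact fun u v huv hu => snd_eq_one_of_reachable e huv hu
  replace φ : M ≃* RAArtinMonoid (Γ.induce U) := hU ▸ φ
  clear hU
  obtain ⟨c⟩ : Nonempty U := by
    by_contra hempty
    rw [not_nonempty_iff] at hempty
    have := hind.1
    obtain ⟨m, hm⟩ := exists_ne (1 : M)
    exact hm (φ.injective ((eq_one_of_count_eq_zero fun v => hempty.elim v).trans (map_one φ).symm))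
  obtain ⟨C, hC⟩ : ∃ C, C = Γᶜ.connectedComponentMk c := ⟨_, rfl⟩
  have hcC : (c : V) ∈ C.supp := hC.symm
  have hsub : C.supp ⊆ U := fun v hv =>
    hreach c v (SimpleGraph.ConnectedComponent.exact (hC.symm.trans hv.symm)) c.2
  let W : Set U := {u | (u : V) ∈ C.supp}
  have ψ := φ.trans (prodEquiv W fun u hu w hw => adj_of_mem_supp_of_notMem_supp C u hu w hw)
  have hWc : IsEmpty (Wᶜ : Set U) := by
    rcases hind.2 _ _ ⟨ψ⟩ with h | h
    · exact absurd (Subsingleton.elim _ _) (gen_ne_one (Γ := (Γ.induce U).induce W) ⟨c, hcC⟩)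
    · exact ⟨fun w => gen_ne_one (Γ := (Γ.induce U).induce Wᶜ) w (Subsingleton.elim _ _)⟩
  have hCU : C.supp = U := hsub.antisymm fun u hu =>
    by_contra fun h => hWc.elim ⟨⟨u, hu⟩, h⟩
  subst hCU
  exact ⟨C, ⟨φ⟩⟩

end RAArtinMonoid

open RAArtinMonoid in
theorem mainTheorem2 {V : Type u} [Countable V] (Γ : SimpleGraph V) :
    List.TFAE [
      ∀ C : CoconnectedComponent Γ, C.supp.Finite → C.graph = ⊥,
      ∀ C : CoconnectedComponent Γ, Monoid.FG (RAArtinMonoid C.graph) →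
        IsFreeMonoid (RAArtinMonoid C.graph),
      ∀ (M : Type u) [Monoid M], IsDirectSummand M (RAArtinMonoid Γ) →
        IsDirectlyIndecomposable M → Monoid.FG M → IsFreeMonoid M,
      HasPropertyAR (RAArtinMonoid Γ)] := by
  tfae_have 1 → 2 := fun h C hC => isFreeMonoid_of_eq_bot (h C (finite_of_fg hC))
  tfae_have 2 → 1 := fun h C hC =>
    have : Finite C.supp := hC
    eq_bot_of_isFreeMonoid (h C fg_of_finite)
  tfae_have 2 → 3 := by
    intro h M _ hM hind hfg
    obtain ⟨C, ⟨e⟩⟩ := exists_mulEquiv_of_isDirectSummand hM hind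
    obtain ⟨α, ⟨e'⟩⟩ := h C (Monoid.fg_of_surjective e.toMonoidHom e.surjective)
    exact ⟨α, ⟨e.trans e'⟩⟩
  tfae_have 3 → 2 := fun h C hC => h _ (isDirectSummand C) (isDirectlyIndecomposable C) hC
  tfae_have 1 → 4 := hasPropertyAR_of_graph_eq_bot
  tfae_have 4 → 1 := graph_eq_bot_of_hasPropertyAR
  tfae_finish
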